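/- Let $n\ge 1$ be an integer and let $D_{2n}=\langle x,y\mid x^n=y^2=1,\ yxy=x^{-1}\rangle$ be the dihedral group of order $2n$. A finite lattice $L$ with $N$ elements is called dismantlable if there is a chain $L_1\subset L_2\subset\dots\subset L_N=L$ of sublattices of $L$ such that $|L_i|=i$ for all $i=1,2,\dots,N$. Then the lattice of all subgroups of $D_{2n}$ is dismantlable if and only if $n=p^m$ for some prime $p$ and some integer $m\ge 0$. -/

import Mathlib

/-- A lattice `L` is *dismantlable* if it is finite and, with `N = |L|`, there is a chain
`L₁ ⊂ L₂ ⊂ ⋯ ⊂ L_N = L` of sublattices of `L` such that `|L_i| = i` for `i = 1, …, N`.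
Only the values of `c` on `{1, …, N}` matter. -/
def IsDismantlable (L : Type*) [Lattice L] : Prop :=
  Finite L ∧ ∃ c : ℕ → Sublattice L,
    StrictMonoOn c (Set.Icc 1 (Nat.card L)) ∧
    c (Nat.card L) = ⊤ ∧
    ∀ i ∈ Set.Icc 1 (Nat.card L), (c i : Set L).ncard = i

/-! If `n` is a prime power, the subgroups of `ZMod n` form a chain. Hence so do the subgroups
without reflections, and two subgroups sharing a reflection are comparable through their rotations.
Deleting minimal elements outside that chain, then the chain itself, dismantles the lattice.
Otherwise two coprime divisors of `n` give disjoint nontrivial `K`, `K'`, and four reflections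
generate a crown, from which no element can be removed first. -/

section Dismantlable

variable {L : Type*} [Lattice L]

/-- If every nonempty member of a family of sublattices has an element whose deletion stays in the
family, then each finite member is the top of a chain that adds one element at a time. -/
theorem exists_sublattice_chain [Finite L] (F : Set L → Prop)
    (hsup : ∀ S, F S → SupClosed S) (hinf : ∀ S, F S → InfClosed S)
    (hdel : ∀ S, F S → S.Nonempty → ∃ x ∈ S, F (S \ {x})) (N : ℕ) :
    ∀ S : Sublattice L, F S → (S : Set L).ncard = N →
      ∃ c : ℕ → Sublattice L, StrictMonoOn c (Set.Iic N) ∧ c N = S ∧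
        ∀ i ≤ N, (c i : Set L).ncard = i := by
  induction N with
  | zero =>
    intro S _ hS
    refine ⟨fun _ => S, ?_, rfl, ?_⟩
    · intro i hi j hj hij
      simp only [Set.mem_Iic] at hi hj
      omega
    · intro i hi
      rw [hS]
      omega
  | succ N ih =>
    intro S hF hS
    have hne : (S : Set L).Nonempty := by
      rw [← Set.ncard_pos (Set.toFinite _)]
      omega
    obtain ⟨x, hx, hFx⟩ := hdel _ hF hne
    let T : Sublattice L := ⟨(S : Set L) \ {x}, hsup _ hFx, hinf _ hFx⟩
    have hT : (T : Set L).ncard = N := by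
      have := Set.ncard_sdiff_singleton_add_one hx (Set.toFinite _)
      change ((S : Set L) \ {x}).ncard = N
      omega
    have hTS : T < S := by
      refine lt_of_le_of_ne (fun y hy => hy.1) fun h => ?_
      rw [← h] at hx
      exact hx.2 rfl
    obtain ⟨c, hc, hcN, hcard⟩ := ih T hFx hT
    refine ⟨fun i => if i ≤ N then c i else S, ?_, by simp, ?_⟩
    · intro i hi j hj hij
      simp only [Set.mem_Iic] at hi hj
      by_cases hjN : j ≤ N
      · simpa [hjN, (hij.le.trans hjN)] using hc (hij.le.trans hjN) hjN hij
      · have hiN : i ≤ N := by omega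
        simp only [hjN, hiN, if_true, if_false]
        refine lt_of_le_of_lt ?_ hTS
        rw [← hcN]
        exact hc.monotoneOn hiN (Set.mem_Iic.2 le_rfl) hiN
    · intro i hi
      by_cases hiN : i ≤ N
      · simpa [hiN] using hcard i hiN
      · simp only [hiN, if_false]
        omega

/-- A finite lattice is dismantlable if it has a lower set `C` that is a chain and such that two
incomparable elements outside `C` meet in `C`. -/
theorem isDismantlable_of_isLowerSet_chain [Finite L] (C : Set L) (hC : IsLowerSet C)
    (hchain : ∀ a ∈ C, ∀ b ∈ C, a ≤ b ∨ b ≤ a)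
    (hmeet : ∀ a ∉ C, ∀ b ∉ C, a ⊓ b ∈ C ∨ a ≤ b ∨ b ≤ a) :
    IsDismantlable L := by
  -- Either `S ⊆ C`, or `S` contains `C` and `S \ C` is an upper set.
  let F : Set L → Prop := fun S => ∀ a ∈ S, a ∉ C → ∀ b, b ∈ C ∨ a ≤ b → b ∈ S
  have hsup : ∀ S, F S → SupClosed S := by
    intro S hS a ha b hb
    by_cases haC : a ∈ C
    · by_cases hbC : b ∈ C
      · rcases hchain a haC b hbC with h | h
        · rwa [sup_eq_right.2 h]
        · rwa [sup_eq_left.2 h]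
      · exact hS b hb hbC _ (Or.inr le_sup_right)
    · exact hS a ha haC _ (Or.inr le_sup_left)
  have hinf : ∀ S, F S → InfClosed S := by
    intro S hS a ha b hb
    have key : a ≤ b ∨ b ≤ a → a ⊓ b ∈ S := by
      rintro (h | h)
      · rwa [inf_eq_left.2 h]
      · rwa [inf_eq_right.2 h]
    by_cases haC : a ∈ C
    · by_cases hbC : b ∈ C
      · exact key (hchain a haC b hbC)
      · exact hS b hb hbC _ (Or.inl (hC inf_le_left haC))
    · by_cases hbC : b ∈ C
      · exact hS a ha haC _ (Or.inl (hC inf_le_right hbC))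
      · rcases hmeet a haC b hbC with h | h
        · exact hS a ha haC _ (Or.inl h)
        · exact key h
  have hdel : ∀ S, F S → S.Nonempty → ∃ x ∈ S, F (S \ {x}) := by
    intro S hS hne
    by_cases hSC : S ⊆ C
    · obtain ⟨x, hx⟩ := hne
      exact ⟨x, hx, fun a ha haC => (haC (hSC ha.1)).elim⟩
    · obtain ⟨x, hx⟩ := Set.Finite.exists_minimal (Set.toFinite (S \ C)) (Set.sdiff_nonempty.2 hSC)
      refine ⟨x, hx.prop.1, fun a ha haC b hb => ⟨hS a ha.1 haC b hb, ?_⟩⟩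
      rintro rfl
      rcases hb with hb | hb
      · exact hx.prop.2 hb
      · exact ha.2 (le_antisymm hb (hx.le_of_le ⟨ha.1, haC⟩ hb))
  obtain ⟨c, hc, hcN, hcard⟩ := exists_sublattice_chain F hsup hinf hdel (Nat.card L) ⊤
    (fun a _ _ b _ => Set.mem_univ b) (by simp [Set.ncard_univ])
  exact ⟨inferInstance, c, hc.mono fun i hi => hi.2, hcN, fun i hi => hcard i hi.2⟩

/-- A dismantlable lattice has no nonempty subset each of whose elements is the join or the meet of
two other elements of the subset. -/
theorem IsDismantlable.eq_empty_of_forall_eq_sup_or_inf (hL : IsDismantlable L) (S : Set L)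
    (hS : ∀ s ∈ S, ∃ u ∈ S, ∃ v ∈ S, u ≠ s ∧ v ≠ s ∧ (s = u ⊔ v ∨ s = u ⊓ v)) : S = ∅ := by
  obtain ⟨hfin, c, hc, htop, hcard⟩ := hL
  by_contra hne
  obtain ⟨s, hs⟩ := Set.nonempty_iff_ne_empty.2 hne
  have hpos : 1 ≤ Nat.card L := by
    have : Nonempty L := ⟨s⟩
    exact Nat.card_pos
  have hone : S ⊆ (c 1 : Set L) := by
    -- Going down the chain, the first `t ∈ S` lost would be the only element lost, so `u` and `v`
    -- survive and force `t` back in.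
    refine Nat.decreasingInduction' (P := fun i => 1 ≤ i → S ⊆ (c i : Set L)) ?_ hpos ?_ le_rfl
    · intro i hi hi1 ih _ t ht
      by_contra hti
      have hiI : i ∈ Set.Icc 1 (Nat.card L) := ⟨hi1, hi.le⟩
      have hiI' : i + 1 ∈ Set.Icc 1 (Nat.card L) := ⟨by omega, hi⟩
      have ih := ih (by omega)
      have hsub : (c i : Set L) ⊆ (c (i + 1) : Set L) \ {t} := by
        intro y hy
        refine ⟨hc.monotoneOn hiI hiI' (Nat.le_succ i) hy, ?_⟩
        rintro rfl
        exact hti hy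
      have heq : (c i : Set L) = (c (i + 1) : Set L) \ {t} := by
        refine Set.eq_of_subset_of_ncard_le hsub ?_ (Set.toFinite _)
        have h1 := Set.ncard_sdiff_singleton_add_one (ih ht) (Set.toFinite _)
        have h2 := hcard i hiI
        have h3 := hcard _ hiI'
        omega
      obtain ⟨u, hu, v, hv, hut, hvt, h⟩ := hS t ht
      have huc : u ∈ c i := by
        rw [← SetLike.mem_coe, heq]
        exact ⟨ih hu, hut⟩
      have hvc : v ∈ c i := by
        rw [← SetLike.mem_coe, heq]
        exact ⟨ih hv, hvt⟩
      rcases h with h | h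
      · exact hti (h ▸ (c i).sup_mem huc hvc)
      · exact hti (h ▸ (c i).inf_mem huc hvc)
    · intro _
      rw [htop]
      exact Set.subset_univ S
  obtain ⟨u, hu, -, -, hus, -⟩ := hS s hs
  have h1 := hcard 1 ⟨le_rfl, hpos⟩
  exact hus ((Set.ncard_le_one (Set.toFinite _)).1 h1.le u (hone hu) s (hone hs))

/-- A crown on four elements obstructs dismantlability. -/
theorem not_isDismantlable_of_crown {a b c d : L}
    (hab : ¬a ≤ b) (hba : ¬b ≤ a) (hbc : ¬b ≤ c) (hcb : ¬c ≤ b)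
    (hcd : ¬c ≤ d) (hdc : ¬d ≤ c) (hda : ¬d ≤ a) (had : ¬a ≤ d)
    (ha : (d ⊔ a) ⊓ (a ⊔ b) ≤ a) (hb : (a ⊔ b) ⊓ (b ⊔ c) ≤ b)
    (hc : (b ⊔ c) ⊓ (c ⊔ d) ≤ c) (hd : (c ⊔ d) ⊓ (d ⊔ a) ≤ d) :
    ¬IsDismantlable L := by
  intro hL
  have h := hL.eq_empty_of_forall_eq_sup_or_inf
    {a, b, c, d, a ⊔ b, b ⊔ c, c ⊔ d, d ⊔ a} ?_
  · exact (Set.insert_nonempty a _).ne_empty h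
  · have ha := le_antisymm (le_inf le_sup_right le_sup_left) ha
    have hb := le_antisymm (le_inf le_sup_right le_sup_left) hb
    have hc := le_antisymm (le_inf le_sup_right le_sup_left) hc
    have hd := le_antisymm (le_inf le_sup_right le_sup_left) hd
    rintro s (rfl | rfl | rfl | rfl | rfl | rfl | rfl | rfl)
    · exact ⟨d ⊔ s, by simp, s ⊔ b, by simp, by simpa, by simpa, Or.inr ha⟩
    · exact ⟨a ⊔ s, by simp, s ⊔ c, by simp, by simpa, by simpa, Or.inr hb⟩
    · exact ⟨b ⊔ s, by simp, s ⊔ d, by simp, by simpa, by simpa, Or.inr hc⟩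
    · exact ⟨c ⊔ s, by simp, s ⊔ a, by simp, by simpa, by simpa, Or.inr hd⟩
    · exact ⟨a, by simp, b, by simp, by simpa, by simpa, Or.inl rfl⟩
    · exact ⟨b, by simp, c, by simp, by simpa, by simpa, Or.inl rfl⟩
    · exact ⟨c, by simp, d, by simp, by simpa, by simpa, Or.inl rfl⟩
    · exact ⟨d, by simp, a, by simp, by simpa, by simpa, Or.inl rfl⟩

end Dismantlable

namespace DihedralGroup

variable {n : ℕ}

/-- The subgroup of rotations by elements of `K` and reflections in the coset `i + K`. -/
def dihedralSubgroup (K : AddSubgroup (ZMod n)) (i : ZMod n) : Subgroup (DihedralGroup n) where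
  carrier := {g | match g with
    | r k => k ∈ K
    | sr k => k - i ∈ K}
  one_mem' := K.zero_mem
  mul_mem' := by
    rintro (a | a) (b | b) ha hb
    · exact K.add_mem ha hb
    · have := K.sub_mem hb ha
      simp only [r_mul_sr, Set.mem_ofPred_eq]
      convert this using 1
      ring
    · have := K.add_mem ha hb
      simp only [sr_mul_r, Set.mem_ofPred_eq]
      convert this using 1
      ring
    · have := K.sub_mem hb ha
      simp only [sr_mul_sr, Set.mem_ofPred_eq]
      convert this using 1
      ring
  inv_mem' := by
    rintro (a | a) ha
    · exact K.neg_mem ha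
    · exact ha

theorem r_mem_dihedralSubgroup {K : AddSubgroup (ZMod n)} {i k : ZMod n} :
    r k ∈ dihedralSubgroup K i ↔ k ∈ K := Iff.rfl

theorem sr_mem_dihedralSubgroup {K : AddSubgroup (ZMod n)} {i k : ZMod n} :
    sr k ∈ dihedralSubgroup K i ↔ k - i ∈ K := Iff.rfl

theorem zpowers_sr_sup_le {K : AddSubgroup (ZMod n)} {i j k : ZMod n} (hj : j - i ∈ K)
    (hk : k - i ∈ K) :
    Subgroup.zpowers (sr j) ⊔ Subgroup.zpowers (sr k) ≤ dihedralSubgroup K i :=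
  sup_le (Subgroup.zpowers_le.2 hj) (Subgroup.zpowers_le.2 hk)

theorem dihedralSubgroup_inf_le {K K' : AddSubgroup (ZMod n)} (h : Disjoint K K') (i : ZMod n) :
    dihedralSubgroup K i ⊓ dihedralSubgroup K' i ≤ Subgroup.zpowers (sr i) := by
  rintro (k | k) ⟨hk, hk'⟩
  · obtain rfl := AddSubgroup.disjoint_def.1 h hk hk'
    exact one_mem _
  · obtain rfl := sub_eq_zero.1 (AddSubgroup.disjoint_def.1 h hk hk')
    exact Subgroup.mem_zpowers _

theorem zpowers_sr_le_zpowers_sr {i j : ZMod n} :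
    Subgroup.zpowers (sr i) ≤ Subgroup.zpowers (sr j) ↔ i = j := by
  refine ⟨fun h => ?_, fun h => h ▸ le_rfl⟩
  have hle : Subgroup.zpowers (sr j) ≤ dihedralSubgroup ⊥ j :=
    Subgroup.zpowers_le.2 (by simp [sr_mem_dihedralSubgroup])
  have hi := hle (h (Subgroup.mem_zpowers _))
  rwa [sr_mem_dihedralSubgroup, AddSubgroup.mem_bot, sub_eq_zero] at hi

/-- Disjoint nontrivial subgroups of rotations obstruct dismantlability. -/
theorem not_isDismantlable_of_disjoint {K K' : AddSubgroup (ZMod n)} (h : Disjoint K K')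
    {u v : ZMod n} (hu : u ∈ K) (hv : v ∈ K') (hu0 : u ≠ 0) (hv0 : v ≠ 0) :
    ¬IsDismantlable (Subgroup (DihedralGroup n)) := by
  -- Around the cycle `0, u, u + v, v` the differences lie alternately in `K` and `K'`, so adjacent
  -- joins share only the common reflection.
  refine not_isDismantlable_of_crown (a := Subgroup.zpowers (sr 0)) (b := Subgroup.zpowers (sr u))
    (c := Subgroup.zpowers (sr (u + v))) (d := Subgroup.zpowers (sr v))
    ?_ ?_ ?_ ?_ ?_ ?_ ?_ ?_ ?_ ?_ ?_ ?_
  any_goals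
    rw [zpowers_sr_le_zpowers_sr]
    simp [hu0, hv0, hu0.symm, hv0.symm]
  · exact (inf_le_inf (zpowers_sr_sup_le (by simpa) (by simp))
      (zpowers_sr_sup_le (by simp) (by simpa))).trans (dihedralSubgroup_inf_le h.symm _)
  · exact (inf_le_inf (zpowers_sr_sup_le (by simpa) (by simp))
      (zpowers_sr_sup_le (by simp) (by simpa))).trans (dihedralSubgroup_inf_le h _)
  · exact (inf_le_inf (zpowers_sr_sup_le (by simpa) (by simp))
      (zpowers_sr_sup_le (by simp) (by simpa))).trans (dihedralSubgroup_inf_le h.symm _)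
  · exact (inf_le_inf (zpowers_sr_sup_le (by simpa) (by simp))
      (zpowers_sr_sup_le (by simp) (by simpa))).trans (dihedralSubgroup_inf_le h _)

/-- The `p`- and `q`-torsion of `ZMod n` are disjoint by Bézout, and contain `n / p` and `n / q`. -/
theorem not_isDismantlable_of_coprime_dvd (hn : 0 < n) {p q : ℕ} (hp : p ∣ n) (hq : q ∣ n)
    (hp1 : 1 < p) (hq1 : 1 < q) (hpq : p.Coprime q) :
    ¬IsDismantlable (Subgroup (DihedralGroup n)) := by
  have hne : ∀ {d : ℕ}, d ∣ n → 1 < d → ((n / d : ℕ) : ZMod n) ≠ 0 := by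
    intro d hd hd1 h0
    rw [ZMod.natCast_eq_zero_iff] at h0
    exact absurd (Nat.le_of_dvd (Nat.div_pos (Nat.le_of_dvd hn hd) (by omega)) h0)
      (not_le.2 (Nat.div_lt_self hn hd1))
  have hmem : ∀ {d : ℕ}, d ∣ n →
      ((n / d : ℕ) : ZMod n) ∈ (AddMonoidHom.mulLeft (d : ZMod n)).ker := by
    intro d hd
    rw [AddMonoidHom.mem_ker, AddMonoidHom.coe_mulLeft, ← Nat.cast_mul, Nat.mul_div_cancel' hd,
      ZMod.natCast_self]
  refine not_isDismantlable_of_disjoint (AddSubgroup.disjoint_def.2 ?_) (hmem hp) (hmem hq)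
    (hne hp hp1) (hne hq hq1)
  intro x hx hx'
  rw [AddMonoidHom.mem_ker, AddMonoidHom.coe_mulLeft] at hx hx'
  obtain ⟨s, t, hst⟩ : IsCoprime (p : ZMod n) (q : ZMod n) := by
    simpa using (Nat.isCoprime_iff_coprime.2 hpq).map (Int.castRingHom (ZMod n))
  calc x = (s * p + t * q) * x := by rw [hst, one_mul]
    _ = s * (p * x) + t * (q * x) := by ring
    _ = 0 := by rw [hx, hx', mul_zero, mul_zero, add_zero]

end DihedralGroup

/-- By Bézout, each element and some power of `p` divide each other. -/
theorem ZMod.dvd_total_of_prime_pow {p m : ℕ} (hp : p.Prime) (x y : ZMod (p ^ m)) :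
    x ∣ y ∨ y ∣ x := by
  have : NeZero (p ^ m) := ⟨pow_ne_zero _ hp.ne_zero⟩
  have key : ∀ z : ZMod (p ^ m), ∃ i : ℕ,
      z ∣ (p : ZMod (p ^ m)) ^ i ∧ (p : ZMod (p ^ m)) ^ i ∣ z := by
    intro z
    obtain ⟨i, -, hi⟩ := (Nat.dvd_prime_pow hp).1 (Nat.gcd_dvd_right z.val (p ^ m))
    refine ⟨i, ?_, ?_⟩
    · refine ⟨(Nat.gcdA z.val (p ^ m) : ℤ), ?_⟩
      have h := congrArg (Int.cast : ℤ → ZMod (p ^ m)) (Nat.gcd_eq_gcd_ab z.val (p ^ m))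
      rw [hi] at h
      push_cast at h
      have h0 : (p : ZMod (p ^ m)) ^ m = 0 := by
        rw [← Nat.cast_pow, ZMod.natCast_self]
      simpa [h0] using h
    · have h := Nat.gcd_dvd_left z.val (p ^ m)
      rw [hi] at h
      simpa using map_dvd (Nat.castRingHom (ZMod (p ^ m))) h
  obtain ⟨i, hxi, hix⟩ := key x
  obtain ⟨j, hyj, hjy⟩ := key y
  exact (le_total i j).imp (fun h => hxi.trans ((pow_dvd_pow _ h).trans hjy))
    (fun h => hyj.trans ((pow_dvd_pow _ h).trans hix))

namespace DihedralGroup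

variable {n : ℕ}

/-- The rotations of a subgroup of a dihedral group. -/
def rotations (H : Subgroup (DihedralGroup n)) : AddSubgroup (ZMod n) where
  carrier := {k | r k ∈ H}
  zero_mem' := H.one_mem
  add_mem' := fun ha hb => by simpa using H.mul_mem ha hb
  neg_mem' := fun ha => by simpa using H.inv_mem ha

theorem mem_rotations {H : Subgroup (DihedralGroup n)} {k : ZMod n} :
    k ∈ rotations H ↔ r k ∈ H := Iff.rfl

theorem le_of_rotations_le {H H' : Subgroup (DihedralGroup n)} {i : ZMod n} (hi : sr i ∈ H)
    (hi' : sr i ∈ H') (h : rotations H ≤ rotations H') : H ≤ H' := by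
  rintro (k | k) hk
  · exact h hk
  · have h1 : r (k - i) ∈ H' := h (mem_rotations.2 (by simpa using H.mul_mem hi hk))
    simpa using H'.mul_mem hi' h1

end DihedralGroup

theorem AddSubgroup.le_total_of_prime_pow {p m : ℕ} (hp : p.Prime)
    (K K' : AddSubgroup (ZMod (p ^ m))) : K ≤ K' ∨ K' ≤ K := by
  have hdvd : ∀ (J : AddSubgroup (ZMod (p ^ m))) {x y : ZMod (p ^ m)}, x ∣ y → x ∈ J → y ∈ J := by
    rintro J x - ⟨c, rfl⟩ hx
    -- Every scalar is an integer, so additive subgroups are ideals.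
    obtain ⟨c, rfl⟩ := ZMod.intCast_surjective c
    rw [mul_comm, ← zsmul_eq_mul]
    exact J.zsmul_mem hx c
  by_contra! h
  obtain ⟨x, hx, hx'⟩ := SetLike.not_le_iff_exists.1 h.1
  obtain ⟨y, hy, hy'⟩ := SetLike.not_le_iff_exists.1 h.2
  rcases ZMod.dvd_total_of_prime_pow hp x y with hxy | hyx
  · exact hy' (hdvd K hxy hx)
  · exact hx' (hdvd K' hyx hy)

theorem DihedralGroup.isDismantlable_of_prime_pow {p m : ℕ} (hp : p.Prime) :
    IsDismantlable (Subgroup (DihedralGroup (p ^ m))) := by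
  have : NeZero (p ^ m) := ⟨pow_ne_zero _ hp.ne_zero⟩
  refine isDismantlable_of_isLowerSet_chain {H | ∀ i, sr i ∉ H}
    (fun H H' hle hH i hi => hH i (hle hi)) ?_ ?_
  · have hle : ∀ H H' : Subgroup (DihedralGroup (p ^ m)), (∀ i, sr i ∉ H) →
        rotations H ≤ rotations H' → H ≤ H' := by
      rintro H H' hH h (k | k) hk
      · exact h hk
      · exact (hH k hk).elim
    intro H hH H' hH'
    exact (AddSubgroup.le_total_of_prime_pow hp (rotations H) (rotations H')).imp
      (hle H H' hH) (hle H' H hH')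
  · intro H _ H' _
    by_cases h : ∃ i, sr i ∈ H ⊓ H'
    · obtain ⟨i, hi, hi'⟩ := h
      exact Or.inr ((AddSubgroup.le_total_of_prime_pow hp (rotations H) (rotations H')).imp
        (le_of_rotations_le hi hi') (le_of_rotations_le hi' hi))
    · exact Or.inl (not_exists.1 h)

theorem theorem2p8 (n : ℕ) (hn : 0 < n) :
    IsDismantlable (Subgroup (DihedralGroup n)) ↔
      ∃ p m : ℕ, p.Prime ∧ n = p ^ m := by
  constructor
  · intro h
    by_cases hn1 : n = 1
    -- `Nat.minFac 1 = 1` is not prime, hence the separate case.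
    · exact ⟨2, 0, Nat.prime_two, by simpa⟩
    · refine ⟨n.minFac, n.primeFactorsList.length, Nat.minFac_prime hn1,
        Nat.eq_prime_pow_of_unique_prime_dvd hn.ne' fun {q} hq hqn => ?_⟩
      by_contra hne
      have hp := Nat.minFac_prime hn1
      exact DihedralGroup.not_isDismantlable_of_coprime_dvd hn n.minFac_dvd hqn hp.one_lt
        hq.one_lt ((Nat.coprime_primes hp hq).2 (Ne.symm hne)) h
  · rintro ⟨p, m, hp, rfl⟩
    exact DihedralGroup.isDismantlable_of_prime_pow hp
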